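/- **Setting.** Fix the number of labels $k\ge 2$. In each round $t=1,2,\dots$ an adversary draws an example $(x_t,Y_t)\in\mathcal X\times 2^{[k]}$, possibly at random and depending on the earlier examples. An online weak learner sees $x_t$ and its own past rounds, and makes a possibly randomized prediction $h_t$, a probability distribution over $[k]$; then $Y_t$ is revealed and the learner is given a cost vector $c_t$ and an importance weight $w_t$. For $Y\subseteq[k]$ let $\mathcal C^Y$ be the set of all $c\in[0,1]^k$ with $\min_l c[l]=0$, $\max_l c[l]=1$ and $c[l]\le c[r]$ for all $l\in Y$, $r\notin Y$, and let $u^Y_\gamma$ be the vector with entries $a+\gamma$ on $Y$ and $a$ off $Y$, where $a$ is such that the entries sum to $1$. A weak learner and an adversary satisfy OnlineWLC$(\delta,\gamma,S)$ if for every $T$ and every adaptive choice of $c_t\in\mathcal C^{Y_t}$, $w_t\in[0,1]$ (based on the past rounds and on $(x_t,Y_t)$, not on $h_t$), with probability at least $1-\delta$, $$\sum_{t=1}^T w_t\,c_t\cdot h_t\le\sum_{t=1}^T w_t\,c_t\cdot u^{Y_t}_\gamma+S .$$ A boosting algorithm with $N$ learners runs $N$ members of a family of weak learners, with independent randomness,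 against the adversary. In round $t$ it outputs a score vector $\hat y_t\in\mathbb R^k$ computed, possibly with its own independent randomness, from the current predictions of its $N$ weak learners and from all that was revealed in earlier rounds, but not directly from $x_t$ (weighted votes of the weak learners are a special case). Then $Y_t$ is revealed, and the algorithm chooses the cost vector and weight of each weak learner. Its error rate over $T\ge1$ rounds (samples) is $\mathbb E\big[\frac1T\sum_{t=1}^T L^{Y_t}(\hat y_t)\big]$, where $L^Y$ is the rank loss $$L^Y(s)=\frac{1}{|Y|\,|Y^c|}\sum_{l\in Y}\sum_{r\notin Y}\Big(\mathbf 1(s[l]<s[r])+\tfrac12\mathbf 1(s[l]=s[r])\Big)$$ (and $L^Y=0$ if $Y$ or $Y^c$ is empty). **Theorem.** For every $k\ge2$ and every $\epsilon_0\in(0,\frac12)$ there is a constant $c>0$, depending only on $k$ and $\epsilon_0$, such that the following holds. For all $\gamma\in(0,\frac1{2k})$, $\delta\in(0,1)$, $\epsilon\in(0,\epsilon_0]$ and $S\ge\frac{k\ln(1/\delta)}{\gamma}$ there are an adversary and a family $(WL^i)_{i\in\mathbb N}$ of weak learners, each satisfying OnlineWLC$(\delta,\gamma,S)$ with that adversary,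 such that every boosting algorithm with $N$ learners from this family whose error rate over $T\ge 1$ samples is less than $\epsilon$ has $$N\ge\frac{c}{\gamma^2}\ln\frac1\epsilon\qquad\text{and}\qquad T\ge\frac{c\,S}{\epsilon\gamma}.$$ -/

import Mathlib

/-!
Online boosting for multi-label ranking with labels `Fin k`.  Histories are lists of rounds, with
the most recent round first.
-/

/-- A weak prediction: a probability distribution over the `k` labels. -/
abbrev WeakPrediction (k : ℕ) : Type := stdSimplex ℝ (Fin k)

/-- The rank loss of the score vector `s` when `Y` is the set of relevant labels. -/
noncomputable def rankLoss {k : ℕ} (Y : Finset (Fin k)) (s : Fin k → ℝ) : ℝ :=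
  1 / ((Y.card : ℝ) * (Yᶜ.card : ℝ)) *
    ∑ l ∈ Y, ∑ r ∈ Yᶜ, ((if s l < s r then 1 else 0) + 1 / 2 * (if s l = s r then 1 else 0))

/-- The edge-over-random cost vectors for the relevant set `Y`: entries in `[0, 1]`, with minimum
`0` and maximum `1`, and no relevant label costs more than an irrelevant one. -/
def eorCosts {k : ℕ} (Y : Finset (Fin k)) : Set (Fin k → ℝ) :=
  {c | (∀ l, c l ∈ Set.Icc (0 : ℝ) 1) ∧ (∀ l ∈ Y, ∀ r ∉ Y, c l ≤ c r) ∧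
    (∃ l, c l = 0) ∧ (∃ l, c l = 1)}

/-- The baseline prediction with edge `γ`: total mass one, and `γ` more mass on each relevant label
than on each irrelevant one. -/
noncomputable def baseline {k : ℕ} (γ : ℝ) (Y : Finset (Fin k)) (l : Fin k) : ℝ :=
  (1 - γ * (Y.card : ℝ)) / (k : ℝ) + if l ∈ Y then γ else 0

/-- What one weak learner knows about one finished round: the instance, the revealed label set, its
own prediction, and the cost vector and importance weight it was given. -/
structure Feedback (k : ℕ) (X : Type) where
  inst : X
  label : Finset (Fin k)
  pred : WeakPrediction k
  cost : Fin k → ℝ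
  weight : ℝ

/-- An adversary: it draws the next labelled example at random, given the earlier ones. -/
abbrev Adversary (k : ℕ) (X : Type) : Type :=
  List (X × Finset (Fin k)) → PMF (X × Finset (Fin k))

/-- An online weak learner: given its own past rounds and the current instance (but neither the
current label set nor the current cost vector) it makes a randomized prediction. -/
abbrev WeakLearner (k : ℕ) (X : Type) : Type :=
  List (Feedback k X) → X → PMF (WeakPrediction k)

/-- An adaptive rule for the cost vector and the importance weight of a round.  It knows the past
rounds and the current example, and does not know the current weak prediction. -/
abbrev CostRule (k : ℕ) (X : Type) : Type :=
  List (Feedback k X) → X → Finset (Fin k) → (Fin k → ℝ) × ℝ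

/-- The rule always issues edge-over-random cost vectors and weights in `[0, 1]`. -/
def CostRule.Valid {k : ℕ} {X : Type} (C : CostRule k X) : Prop :=
  ∀ hist x Y, (C hist x Y).1 ∈ eorCosts Y ∧ (C hist x Y).2 ∈ Set.Icc (0 : ℝ) 1

/-- The law of the first `T` rounds of one weak learner facing the adversary under a cost rule. -/
noncomputable def learnerRun {k : ℕ} {X : Type} (adv : Adversary k X) (L : WeakLearner k X)
    (C : CostRule k X) : ℕ → PMF (List (Feedback k X))
  | 0 => PMF.pure []
  | T + 1 => (learnerRun adv L C T).bind fun hist =>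
      (adv (hist.map fun f => (f.inst, f.label))).bind fun e =>
        (L hist e.1).map fun h =>
          { inst := e.1, label := e.2, pred := h,
            cost := (C hist e.1 e.2).1, weight := (C hist e.1 e.2).2 } :: hist

/-- The online weak learning condition with confidence `δ`, edge `γ` and excess loss `S` for a pair
of a weak learner and an adversary. -/
def OnlineWLC {k : ℕ} {X : Type} (δ γ S : ℝ) (L : WeakLearner k X) (adv : Adversary k X) : Prop :=
  ∀ (T : ℕ) (C : CostRule k X), C.Valid →
    ENNReal.ofReal (1 - δ) ≤ (learnerRun adv L C T).toOuterMeasure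
      {hist | (hist.map fun f => f.weight * ∑ l, f.cost l * f.pred.1 l).sum ≤
        (hist.map fun f => f.weight * ∑ l, f.cost l * baseline γ f.label l).sum + S}

/-- A finished round of a booster with `N` weak learners: the labelled example, the weak
predictions, the final score vector, and the cost vector and weight given to each weak learner. -/
structure BoostRound (k N : ℕ) (X : Type) where
  inst : X
  label : Finset (Fin k)
  preds : Fin N → WeakPrediction k
  score : Fin k → ℝ
  costs : Fin N → Fin k → ℝ
  weights : Fin N → ℝ

/-- The part of a round that the `i`-th weak learner sees. -/
def BoostRound.feedback {k N : ℕ} {X : Type} (i : Fin N) (r : BoostRound k N X) : Feedback k X where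
  inst := r.inst
  label := r.label
  pred := r.preds i
  cost := r.costs i
  weight := r.weights i

/-- A boosting algorithm with `N` weak learners, with internal randomness in `Ω`.
`decide` turns the `N` current weak predictions into a score vector.  The rule may be any function
of these predictions, of all finished rounds and of the internal randomness; in particular it may be
a weighted vote of an initial segment of the weak learners, with weights and segment chosen in any
way from this information.  `task` gives each weak learner a cost vector and an importance weight
once the label set is revealed. -/
structure Booster (k N : ℕ) (X : Type) (Ω : Type*) where
  decide : Ω → List (BoostRound k N X) → (Fin N → WeakPrediction k) → Fin k → ℝ
  task : Ω → List (BoostRound k N X) → X → Finset (Fin k) → (Fin N → WeakPrediction k) →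
    Fin N → (Fin k → ℝ) × ℝ

/-- The law of a tuple with independent entries. -/
noncomputable def independentDraws {α : Type} : (n : ℕ) → (Fin n → PMF α) → PMF (Fin n → α)
  | 0, _ => PMF.pure Fin.elim0
  | n + 1, p => (p 0).bind fun a =>
      (independentDraws n fun i => p i.succ).map fun f => Fin.cons a f

/-- The law of the first `T` rounds of a booster run with the weak learners `WL 0, …, WL (N - 1)`
against the adversary, for a given value `ω` of the internal randomness of the booster.  The weak
learners use independent randomness. -/
noncomputable def boostRun {k N : ℕ} {X : Type} {Ω : Type*} (adv : Adversary k X)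
    (WL : Fin N → WeakLearner k X) (B : Booster k N X Ω) (ω : Ω) :
    ℕ → PMF (List (BoostRound k N X))
  | 0 => PMF.pure []
  | T + 1 => (boostRun adv WL B ω T).bind fun hist =>
      (adv (hist.map fun r => (r.inst, r.label))).bind fun e =>
        (independentDraws N fun i => WL i (hist.map (BoostRound.feedback i)) e.1).map fun h =>
          { inst := e.1, label := e.2, preds := h, score := B.decide ω hist h,
            costs := fun i => (B.task ω hist e.1 e.2 h i).1,
            weights := fun i => (B.task ω hist e.1 e.2 h i).2 } :: hist

/-- The error rate over `T` rounds: the expected average rank loss of the final score vectors, over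
the adversary, the weak learners and the internal randomness of the booster. -/
noncomputable def errorRate {k N : ℕ} {X : Type} {Ω : Type*} [MeasurableSpace Ω]
    (P : MeasureTheory.Measure Ω) (adv : Adversary k X) (WL : Fin N → WeakLearner k X)
    (B : Booster k N X Ω) (T : ℕ) : ENNReal :=
  MeasureTheory.lintegral P fun ω => ∑' hist, boostRun adv WL B ω T hist *
    ENNReal.ofReal ((hist.map fun r => rankLoss r.label r.score).sum / (T : ℝ))

/-!
The adversary draws a uniformly random label `y`, announces the relevant set `{y}`, and tells the
weak learners `y` through the instance. A learner names a random label, drawn with edge `3γ` towards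
`y`. Exempt from this are the *uninformative* rounds, flagged in the instance, in which the label is
drawn with no edge at all. Round `t` is uninformative with probability `min (t + 1) b - min t b`,
where `b = S / (4γ)`; so these are the first rounds, `b` of them in expectation. Randomizing the
last one matters when `b` is not an integer, in particular when `b < 1`.

*Weak learning condition.* With `λ = 2γ / k`, the surplus edge `2γ` of the informative rounds
outweighs the second-order term of `exp (λ · regret)`, so these rounds do not increase its
expectation, and an uninformative round increases it by a factor `1 + 2λγ` at most
(`sum_tripleEdge_mul_exp_le`). Hence `exp (λ · regret)` has expectation at most
`exp (2λγb) = exp (λS / 2)`, and Markov's inequality bounds the probability of a regret above `S` by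
`exp (-λS / 2) = exp (-γS / k) ≤ δ` (`onlineWLC_namingLearner`).

*Number of samples.* In an uninformative round the predictions are independent of the label, so that
the expected rank loss is at least `1 / 2`. Hence the total loss over `T` rounds is at least
`min T b / 2`, and an error rate below `ε < 1 / 2` forces `T > b / (2ε)`.

*Number of learners.* In an informative round the expected rank loss is at least half the smallest
overlap `m = ∑ min (P_a, P_b)` of the laws of the `N` predictions given two labels
(`half_le_average_rankLoss`), and by the Cauchy-Schwarz inequality `m (2 - m)` is at least the square
of their Bhattacharyya coefficient (`overlap_ge_of_sum_sqrt`). The latter is multiplicative, and its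
`N`-th root is at least `exp (-36 k γ²)` (`exp_neg_le_sum_sqrt_baseline`). So an error rate below `ε`
forces `exp (-72 k γ² N) < 4 ε (1 - ε)`, and `ln (1 / (4 ε (1 - ε)))` is comparable to `ln (1 / ε)`
for `ε ≤ ε₀ < 1 / 2`. The exact form `m (2 - m)` is what makes this work up to `ε₀` near `1 / 2`.
-/

/-! ### Expectations under probability mass functions -/

namespace PMF

/-- The expectation of an extended nonnegative function under a probability mass function. -/
noncomputable def expect {α : Type*} (p : PMF α) (f : α → ENNReal) : ENNReal := ∑' a, p a * f a

section

variable {α β : Type*}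

theorem expect_pure (a : α) (f : α → ENNReal) : (PMF.pure a).expect f = f a := by
  unfold expect
  rw [tsum_eq_single a (by intro b hb; simp [hb])]
  simp

theorem expect_bind (p : PMF α) (q : α → PMF β) (f : β → ENNReal) :
    (p.bind q).expect f = p.expect fun a => (q a).expect f := by
  simp only [expect, PMF.bind_apply, ← ENNReal.tsum_mul_right, ← ENNReal.tsum_mul_left]
  rw [ENNReal.tsum_comm]
  simp only [mul_assoc]

theorem expect_map (p : PMF α) (g : α → β) (f : β → ENNReal) :
    (p.map g).expect f = p.expect fun a => f (g a) := by
  rw [← PMF.bind_pure_comp, expect_bind]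
  simp only [Function.comp, expect_pure]

theorem expect_const (p : PMF α) (c : ENNReal) : (p.expect fun _ => c) = c := by
  rw [expect, ENNReal.tsum_mul_right, p.tsum_coe, one_mul]

theorem expect_add (p : PMF α) (f g : α → ENNReal) :
    (p.expect fun a => f a + g a) = p.expect f + p.expect g := by
  simp only [expect, mul_add, ENNReal.tsum_add]

theorem expect_mul_const (p : PMF α) (f : α → ENNReal) (c : ENNReal) :
    (p.expect fun a => f a * c) = p.expect f * c := by
  simp only [expect, ← mul_assoc, ENNReal.tsum_mul_right]

theorem expect_mono_of_support (p : PMF α) {f g : α → ENNReal}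
    (h : ∀ a ∈ p.support, f a ≤ g a) : p.expect f ≤ p.expect g := by
  refine ENNReal.tsum_le_tsum fun a => ?_
  by_cases ha : p a = 0
  · simp [ha]
  · exact mul_le_mul_right (h a ((p.mem_support_iff a).2 ha)) _

theorem expect_mono (p : PMF α) {f g : α → ENNReal} (h : ∀ a, f a ≤ g a) :
    p.expect f ≤ p.expect g :=
  p.expect_mono_of_support fun a _ => h a

/-- **Markov's inequality**, as a lower bound for the probability of the set `s` when `f ≥ 1`
outside of `s`. -/
theorem ofReal_one_sub_le_toOuterMeasure (p : PMF α) (s : Set α) {f : α → ENNReal} {δ : ℝ}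
    (hδ : 0 ≤ δ) (hf : ∀ a ∉ s, 1 ≤ f a) (h : p.expect f ≤ ENNReal.ofReal δ) :
    ENNReal.ofReal (1 - δ) ≤ p.toOuterMeasure s := by
  have h1 : (1 : ENNReal) ≤ p.toOuterMeasure s + ENNReal.ofReal δ := by
    calc (1 : ENNReal) = p.expect fun _ => 1 := (p.expect_const 1).symm
      _ ≤ p.expect fun a => s.indicator 1 a + f a := by
          refine p.expect_mono fun a => ?_
          by_cases ha : a ∈ s
          · simp [ha]
          · simpa [ha] using hf a ha
      _ = p.toOuterMeasure s + p.expect f := by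
          rw [expect_add, PMF.toOuterMeasure_apply, expect]
          congr 2
          funext a
          by_cases ha : a ∈ s <;> simp [ha]
      _ ≤ _ := by gcongr
  rw [ENNReal.ofReal_sub _ hδ, ENNReal.ofReal_one]
  exact tsub_le_iff_right.2 h1

/-- The probability mass function with real weights `w`. -/
noncomputable def ofSimplex [Fintype α] (w : stdSimplex ℝ α) : PMF α :=
  PMF.ofFintype (fun a => ENNReal.ofReal (w.1 a)) <| by
    rw [← ENNReal.ofReal_sum_of_nonneg fun a _ => w.2.1 a, w.2.2, ENNReal.ofReal_one]

theorem expect_ofSimplex [Fintype α] (w : stdSimplex ℝ α) {f : α → ℝ}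
    (hf : ∀ a, 0 ≤ f a) :
    ((ofSimplex w).expect fun a => ENNReal.ofReal (f a)) =
      ENNReal.ofReal (∑ a, w.1 a * f a) := by
  rw [expect, tsum_fintype,
    ENNReal.ofReal_sum_of_nonneg fun a _ => mul_nonneg (w.2.1 a) (hf a)]
  refine Finset.sum_congr rfl fun a _ => ?_
  rw [ENNReal.ofReal_mul (w.2.1 a)]
  rfl

end

end PMF

theorem Fintype.sum_pi_fin_succ {α M : Type*} [Fintype α] [AddCommMonoid M] {n : ℕ}
    (F : (Fin (n + 1) → α) → M) :
    ∑ f, F f = ∑ a, ∑ f : Fin n → α, F (Fin.cons a f) := by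
  rw [← (Fin.consEquiv fun _ : Fin (n + 1) => α).sum_comp, Fintype.sum_prod_type]
  rfl

/-- The expectation over independent draws from a finite law, as a sum over all tuples. -/
theorem expect_independentDraws {α β : Type} [Fintype β] (w : stdSimplex ℝ β) (v : β → α) :
    ∀ (n : ℕ) {g : (Fin n → α) → ℝ}, (∀ h, 0 ≤ g h) →
      ((independentDraws n fun _ => (PMF.ofSimplex w).map v).expect fun h => ENNReal.ofReal (g h)) =
        ENNReal.ofReal (∑ f : Fin n → β, (∏ i, w.1 (f i)) * g fun i => v (f i))
  | 0, g, _ => by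
      rw [independentDraws, PMF.expect_pure, Fintype.sum_unique]
      simp only [Finset.univ_eq_empty, Finset.prod_empty, one_mul]
      congr 2
      exact Subsingleton.elim _ _
  | n + 1, g, hg => by
      rw [independentDraws, PMF.expect_bind, PMF.expect_map]
      simp only [PMF.expect_map]
      have ih := fun b => expect_independentDraws w v n (g := fun f => g (Fin.cons (v b) f))
        fun h => hg _
      simp only [ih]
      rw [PMF.expect_ofSimplex w fun b => Finset.sum_nonneg fun f _ =>
        mul_nonneg (Finset.prod_nonneg fun i _ => w.2.1 _) (hg _), Fintype.sum_pi_fin_succ]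
      congr 1
      refine Finset.sum_congr rfl fun b _ => ?_
      rw [Finset.mul_sum]
      refine Finset.sum_congr rfl fun f _ => ?_
      rw [Fin.prod_univ_succ, ← mul_assoc]
      congr 2
      funext i
      refine Fin.cases ?_ (fun j => ?_) i <;> simp

/-! ### Regret of one round -/

section Baseline

variable {k : ℕ}

theorem baseline_singleton (g : ℝ) (y l : Fin k) :
    baseline g {y} l = (1 - g) / k + if l = y then g else 0 := by
  simp [baseline]

theorem sum_mul_baseline_singleton (c : Fin k → ℝ) (g : ℝ) (y : Fin k) :
    ∑ l, c l * baseline g {y} l = (1 - g) * ((∑ l, c l) / k) + g * c y := by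
  simp only [baseline_singleton, mul_add, Finset.sum_add_distrib, ← Finset.sum_mul]
  simp
  ring

theorem baseline_singleton_nonneg {g : ℝ} (hg : 0 ≤ g) (hg' : g ≤ 1) (y l : Fin k) :
    0 ≤ baseline g {y} l := by
  rw [baseline_singleton]
  have : 0 ≤ (1 - g) / k := div_nonneg (by linarith) (Nat.cast_nonneg k)
  split_ifs <;> linarith

theorem sum_baseline_singleton (g : ℝ) (y : Fin k) : ∑ l, baseline g {y} l = 1 := by
  have hk : (k : ℝ) ≠ 0 := by
    have := y.pos
    positivity
  have := sum_mul_baseline_singleton (fun _ => 1) g y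
  simp only [one_mul] at this
  rw [this]
  simp [hk]

/-- The baseline distribution with edge `g` towards the label `y`. -/
noncomputable def baselineSimplex (g : unitInterval) (y : Fin k) : stdSimplex ℝ (Fin k) :=
  ⟨baseline g {y}, baseline_singleton_nonneg g.2.1 g.2.2 y, sum_baseline_singleton g.1 y⟩

/-- The minimum `0` of an edge-over-random cost vector is attained at a single relevant label. -/
theorem cost_self_eq_zero {y : Fin k} {c : Fin k → ℝ} (hc : c ∈ eorCosts {y}) : c y = 0 := by
  obtain ⟨h1, h2, ⟨l, hl⟩, -⟩ := hc
  by_cases h : l = y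
  · rwa [← h]
  · have := h2 y (by simp) l (by simpa using h)
    linarith [(h1 y).1]

theorem one_le_sum_cost {y : Fin k} {c : Fin k → ℝ} (hc : c ∈ eorCosts {y}) : 1 ≤ ∑ l, c l := by
  obtain ⟨h1, -, -, ⟨l, hl⟩⟩ := hc
  rw [← hl]
  exact Finset.single_le_sum (fun i _ => (h1 i).1) (Finset.mem_univ l)

theorem sum_cost_le {Y : Finset (Fin k)} {c : Fin k → ℝ} (hc : c ∈ eorCosts Y) :
    ∑ l, c l ≤ k := by
  calc ∑ l, c l ≤ ∑ _l : Fin k, (1 : ℝ) := Finset.sum_le_sum fun l _ => (hc.1 l).2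
    _ = k := by simp

/-- The moment generating function of the weighted regret of one round, when the learner names a
label drawn with edge `g`. -/
theorem sum_baseline_mul_exp_le {γ g lam w : ℝ} (hγ : 0 ≤ γ) (hγ' : γ ≤ 1) (hg : 0 ≤ g)
    (hg' : g ≤ 1) (hl : 0 ≤ lam) (hl' : lam ≤ 1) (hw : w ∈ Set.Icc (0 : ℝ) 1) {y : Fin k}
    {c : Fin k → ℝ} (hc : c ∈ eorCosts {y}) :
    ∑ l, baseline g {y} l * Real.exp (lam * (w * c l - w * ∑ j, c j * baseline γ {y} j)) ≤
      1 + lam * (w * ((γ - g) * ((∑ l, c l) / k) + lam * w)) := by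
  obtain ⟨u, hu⟩ : ∃ u, u = ∑ j, c j * baseline γ {y} j := ⟨_, rfl⟩
  rw [← hu]
  have hcy := cost_self_eq_zero hc
  have hu0 : 0 ≤ u := hu ▸ Finset.sum_nonneg fun j _ =>
    mul_nonneg (hc.1 j).1 (baseline_singleton_nonneg hγ hγ' y j)
  have hu1 : u ≤ 1 := by
    rw [hu, ← sum_baseline_singleton γ y]
    exact Finset.sum_le_sum fun j _ =>
      mul_le_of_le_one_left (baseline_singleton_nonneg hγ hγ' y j) (hc.1 j).2
  have key : ∀ l, Real.exp (lam * (w * c l - w * u)) ≤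
      1 + lam * w * (c l - u) + lam ^ 2 * w ^ 2 := by
    intro l
    have h1 : |c l - u| ≤ 1 := by
      rw [abs_le]
      constructor <;> linarith [(hc.1 l).1, (hc.1 l).2]
    have h2 : |lam * (w * c l - w * u)| ≤ lam * w := by
      rw [← mul_sub, ← mul_assoc, abs_mul, abs_of_nonneg (mul_nonneg hl hw.1)]
      exact mul_le_of_le_one_right (mul_nonneg hl hw.1) h1
    have h3 : lam * w ≤ 1 := mul_le_one₀ hl' hw.1 hw.2
    -- `exp x ≤ 1 + x + x²` for `|x| ≤ 1`
    have h4 := (abs_le.1 (Real.abs_exp_sub_one_sub_id_le (h2.trans h3))).2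
    have h5 := sq_le_sq' (by linarith [(abs_le.1 h2).1]) (abs_le.1 h2).2
    nlinarith
  calc _ ≤ ∑ l, baseline g {y} l * (1 + lam * w * (c l - u) + lam ^ 2 * w ^ 2) :=
        Finset.sum_le_sum fun l _ =>
          mul_le_mul_of_nonneg_left (key l) (baseline_singleton_nonneg hg hg' y l)
    _ = (1 - lam * w * u + lam ^ 2 * w ^ 2) * ∑ l, baseline g {y} l
          + lam * w * ∑ l, c l * baseline g {y} l := by
        rw [Finset.mul_sum, Finset.mul_sum, ← Finset.sum_add_distrib]
        exact Finset.sum_congr rfl fun l _ => by ring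
    _ = _ := by
        rw [sum_baseline_singleton, hu, sum_mul_baseline_singleton, sum_mul_baseline_singleton, hcy]
        ring

end Baseline

/-! ### The adversary, the weak learners and the weak learning condition -/

section Game

variable {k : ℕ}

/-- The weights of an instance `(y, b)`: the label `y` is uniform, and independently `b = false`
(an instance about which the learners know nothing) with probability `p`. -/
noncomputable def roundSimplex [NeZero k] (p : unitInterval) : stdSimplex ℝ (Fin k × Bool) :=
  ⟨fun x => (if x.2 then 1 - p.1 else p.1) / k, fun x => by
    have h1 := p.2.1
    have h2 := p.2.2
    have : 0 ≤ if x.2 then 1 - p.1 else p.1 := by split_ifs <;> linarith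
    positivity, by
    have : (k : ℝ) ≠ 0 := Nat.cast_ne_zero.2 (NeZero.ne k)
    rw [Fintype.sum_prod_type]
    simp
    field_simp
    ring⟩

/-- The probability that round `t` is uninformative: these probabilities are in `[0, 1]` and add up
to `min T b` over the first `T` rounds, so that the real number `b` is the expected number of
uninformative rounds. -/
noncomputable def uninformativeProb (b : ℝ) (t : ℕ) : unitInterval :=
  ⟨min ((t : ℝ) + 1) b - min (t : ℝ) b, by
    constructor
    · exact sub_nonneg.2 (min_le_min_right _ (by linarith))
    · rcases le_total (t : ℝ) b with h | h
      · rw [min_eq_left h]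
        linarith [min_le_left ((t : ℝ) + 1) b]
      · rw [min_eq_right h]
        linarith [min_le_right ((t : ℝ) + 1) b]⟩

theorem sum_uninformativeProb {b : ℝ} (hb : 0 ≤ b) (T : ℕ) :
    ∑ t ∈ Finset.range T, (uninformativeProb b t : ℝ) = min (T : ℝ) b := by
  induction T with
  | zero => simp [hb]
  | succ T ih =>
    rw [Finset.sum_range_succ, ih, uninformativeProb]
    push_cast
    ring

/-- The adversary: the relevant set is a uniformly random singleton, which the instance reveals to
the weak learner together with the bit that says whether the round is informative. -/
noncomputable def singletonAdversary [NeZero k] (b : ℝ) : Adversary k (Fin k × Bool) :=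
  fun hist => (PMF.ofSimplex (roundSimplex (uninformativeProb b hist.length))).map
    fun x => (x, {x.1})

theorem expect_singletonAdversary [NeZero k] (b : ℝ)
    (hist : List ((Fin k × Bool) × Finset (Fin k)))
    {f : (Fin k × Bool) × Finset (Fin k) → ENNReal} {R : Fin k → Bool → ℝ} (hR : ∀ y i, 0 ≤ R y i)
    (h : ∀ y i, f ((y, i), {y}) = ENNReal.ofReal (R y i)) :
    (singletonAdversary b hist).expect f =
      ENNReal.ofReal (uninformativeProb b hist.length * ((∑ y, R y false) / k) +
        (1 - uninformativeProb b hist.length) * ((∑ y, R y true) / k)) := by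
  rw [singletonAdversary, PMF.expect_map]
  have : (fun x : Fin k × Bool => f (x, {x.1})) = fun x => ENNReal.ofReal (R x.1 x.2) :=
    funext fun x => h x.1 x.2
  rw [this, PMF.expect_ofSimplex _ (f := fun x : Fin k × Bool => R x.1 x.2)
    fun x => hR x.1 x.2,
    Fintype.sum_prod_type]
  congr 1
  simp only [roundSimplex, Fintype.sum_bool, if_true, Bool.false_eq_true, if_false,
    Finset.sum_add_distrib, ← Finset.mul_sum]
  ring

/-- The memoryless weak learner which names a random label, drawn with edge `g true` towards the
relevant label in an informative round and with edge `g false` in an uninformative one. -/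
noncomputable def namingLearner (g : Bool → unitInterval) : WeakLearner k (Fin k × Bool) :=
  fun _ x => (PMF.ofSimplex (baselineSimplex (g x.2) x.1)).map stdSimplex.vertex

/-- The weighted regret of a learner against the baseline with edge `γ`. -/
noncomputable def regret {X : Type} (γ : ℝ) (hist : List (Feedback k X)) : ℝ :=
  (hist.map fun f => f.weight * ∑ l, f.cost l * f.pred.1 l).sum -
    (hist.map fun f => f.weight * ∑ l, f.cost l * baseline γ f.label l).sum

theorem regret_cons {X : Type} (γ : ℝ) (f : Feedback k X) (hist : List (Feedback k X)) :
    regret γ (f :: hist) = (f.weight * ∑ l, f.cost l * f.pred.1 l -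
      f.weight * ∑ l, f.cost l * baseline γ f.label l) + regret γ hist := by
  simp only [regret, List.map_cons, List.sum_cons]
  ring

theorem sum_mul_vertex (c : Fin k → ℝ) (l : Fin k) :
    ∑ j, c j * (stdSimplex.vertex (S := ℝ) l).1 j = c l := by
  simp [Pi.single_apply]

/-- Edge `3γ` in informative rounds and no edge in uninformative ones. -/
noncomputable def tripleEdge (γ : ℝ) (hγ : 0 ≤ γ) (hγ' : 3 * γ ≤ 1) (i : Bool) : unitInterval :=
  if i then ⟨3 * γ, by linarith, hγ'⟩ else 0

/-- The moment generating function of the regret of one round at `2γ / k`: the surplus edge `2γ` of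
the informative rounds pays for the variance, and an uninformative round costs a factor
`1 + 2 (2γ / k) γ` at most. -/
theorem sum_tripleEdge_mul_exp_le (hk : 2 ≤ k) {γ : ℝ} (hγ : 0 ≤ γ) (hγ' : 3 * γ ≤ 1) (y : Fin k)
    (i : Bool) {c : Fin k → ℝ} (hc : c ∈ eorCosts {y}) {w : ℝ} (hw : w ∈ Set.Icc (0 : ℝ) 1) :
    ∑ l, (baselineSimplex (tripleEdge γ hγ hγ' i) y).1 l *
        Real.exp (2 * γ / k * (w * c l - w * ∑ j, c j * baseline γ {y} j)) ≤
      if i then 1 else 1 + 2 * (2 * γ / k * γ) := by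
  have hk' : (2 : ℝ) ≤ k := by exact_mod_cast hk
  have hk0 : (0 : ℝ) < k := by linarith
  have hlγ : 2 * γ / k ≤ γ := by
    rw [div_le_iff₀ hk0]
    nlinarith
  have hl0 : 0 ≤ 2 * γ / k := by positivity
  have hD : 1 / (k : ℝ) ≤ (∑ l, c l) / k := by
    gcongr
    exact one_le_sum_cost hc
  have hD' : (∑ l, c l) / k ≤ 1 := (div_le_one hk0).2 (sum_cost_le hc)
  have hD0 : 0 ≤ (∑ l, c l) / k := le_trans (by positivity) hD
  refine (sum_baseline_mul_exp_le hγ (by linarith) (tripleEdge γ hγ hγ' i).2.1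
    (tripleEdge γ hγ hγ' i).2.2 hl0 (by linarith) hw hc).trans ?_
  cases i with
  | true =>
    simp only [tripleEdge, if_true]
    have h1 : (γ - 3 * γ) * ((∑ l, c l) / k) + 2 * γ / k * w ≤ 0 := by
      have h2 : 2 * γ * (1 / (k : ℝ)) ≤ 2 * γ * ((∑ l, c l) / k) := by gcongr
      have h3 : 2 * γ / k * w ≤ 2 * γ / k := mul_le_of_le_one_right hl0 hw.2
      have h4 : 2 * γ * (1 / (k : ℝ)) = 2 * γ / k := by ring
      linarith
    have := mul_nonpos_of_nonneg_of_nonpos hl0 (mul_nonpos_of_nonneg_of_nonpos hw.1 h1)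
    linarith
  | false =>
    simp only [tripleEdge]
    have h1 : w * ((γ - 0) * ((∑ l, c l) / k) + 2 * γ / k * w) ≤ 2 * γ := by
      have h2 : γ * ((∑ l, c l) / k) ≤ γ := mul_le_of_le_one_right hγ hD'
      have h3 : 2 * γ / k * w ≤ 2 * γ / k := mul_le_of_le_one_right hl0 hw.2
      have h4 : 0 ≤ γ * ((∑ l, c l) / k) + 2 * γ / k * w :=
        add_nonneg (mul_nonneg hγ hD0) (mul_nonneg hl0 hw.1)
      rw [sub_zero]
      exact (mul_le_of_le_one_left h4 hw.2).trans (by linarith)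
    have := mul_le_mul_of_nonneg_left h1 hl0
    simp only [Bool.false_eq_true, if_false]
    calc _ ≤ 1 + 2 * γ / k * (2 * γ) := by simpa using this
      _ = _ := by ring

/-- The exponential of the regret, discounted by what the uninformative rounds may cost, is a
supermartingale. -/
theorem expect_exp_regret_le [NeZero k] (hk : 2 ≤ k) {γ : ℝ} (hγ : 0 ≤ γ) (hγ' : 3 * γ ≤ 1)
    {b : ℝ} (hb : 0 ≤ b) {C : CostRule k (Fin k × Bool)} (hC : C.Valid) (T : ℕ) :
    (learnerRun (singletonAdversary b) (namingLearner (tripleEdge γ hγ hγ')) C T).expect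
      (fun hist => ENNReal.ofReal (Real.exp (2 * γ / k * regret γ hist -
        2 * (2 * γ / k * γ) * min (hist.length : ℝ) b))) ≤ 1 := by
  obtain ⟨lam, hlam⟩ : ∃ lam : ℝ, lam = 2 * γ / k := ⟨_, rfl⟩
  have hl0 : 0 ≤ lam := by rw [hlam]; positivity
  induction T with
  | zero =>
    rw [learnerRun, PMF.expect_pure]
    simp [regret, hb]
  | succ T ih =>
    rw [learnerRun, PMF.expect_bind]
    refine le_trans (PMF.expect_mono _ fun hist => ?_) ih
    rw [PMF.expect_bind]
    simp only [PMF.expect_map, namingLearner, regret_cons, List.length_cons, sum_mul_vertex,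
      ← hlam]
    set A := lam * regret γ hist - 2 * (lam * γ) * min (hist.length : ℝ) b with hA
    set q := uninformativeProb b hist.length with hq
    have hfac : ∀ z : ℝ, Real.exp (lam * (z + regret γ hist) - 2 * (lam * γ) *
        min ((hist.length + 1 : ℕ) : ℝ) b) =
        Real.exp (lam * z) * Real.exp (A - 2 * (lam * γ) * q) := by
      intro z
      rw [← Real.exp_add, hA, hq, uninformativeProb]
      push_cast
      congr 1
      ring
    simp only [hfac]
    have hfac2 : ∀ (y : Fin k) (i : Bool),
        ((PMF.ofSimplex (baselineSimplex (tripleEdge γ hγ hγ' i) y)).expect fun l =>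
          ENNReal.ofReal (Real.exp (lam * ((C hist (y, i) {y}).2 * (C hist (y, i) {y}).1 l -
            (C hist (y, i) {y}).2 * ∑ j, (C hist (y, i) {y}).1 j * baseline γ {y} j)) *
            Real.exp (A - 2 * (lam * γ) * q))) ≤
        ENNReal.ofReal ((if i then 1 else 1 + 2 * (lam * γ)) *
          Real.exp (A - 2 * (lam * γ) * q)) := by
      intro y i
      rw [PMF.expect_ofSimplex _ fun l => by positivity]
      refine ENNReal.ofReal_le_ofReal ?_
      simp only [← mul_assoc]
      rw [← Finset.sum_mul]
      refine mul_le_mul_of_nonneg_right ?_ (Real.exp_nonneg _)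
      rw [hlam]
      have := sum_tripleEdge_mul_exp_le hk hγ hγ' y i (hC hist (y, i) {y}).1 (hC hist (y, i) {y}).2
      simpa only [← mul_assoc] using this
    have hk0 : (k : ℝ) ≠ 0 := Nat.cast_ne_zero.2 (NeZero.ne k)
    calc _ ≤ (singletonAdversary b (hist.map fun f => (f.inst, f.label))).expect
          fun e => ENNReal.ofReal ((if e.1.2 then 1 else 1 + 2 * (lam * γ)) *
            Real.exp (A - 2 * (lam * γ) * q)) := by
          refine PMF.expect_mono_of_support _ ?_
          rintro ⟨⟨y, i⟩, Y⟩ he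
          obtain ⟨x, -, hx⟩ := (PMF.mem_support_map_iff _ _ _).1 he
          obtain ⟨h1, rfl⟩ := Prod.mk.inj hx
          subst h1
          exact hfac2 y i
      _ = ENNReal.ofReal ((1 + 2 * (lam * γ) * q) * Real.exp (A - 2 * (lam * γ) * q)) := by
          rw [expect_singletonAdversary (R := fun _ i => (if i then 1 else 1 + 2 * (lam * γ)) *
            Real.exp (A - 2 * (lam * γ) * q)) b _
            (fun y i => by split_ifs <;> positivity) fun _ _ => rfl]
          rw [List.length_map, ← hq]
          congr 1
          simp
          field_simp
          ring
      _ ≤ ENNReal.ofReal (Real.exp A) := by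
          refine ENNReal.ofReal_le_ofReal ?_
          rw [Real.exp_sub, mul_div_assoc', div_le_iff₀ (Real.exp_pos _), mul_comm]
          gcongr
          linarith [Real.add_one_le_exp (2 * (lam * γ) * q)]

/-- The weak learning condition: Markov's inequality for the exponential of the regret. -/
theorem onlineWLC_namingLearner [NeZero k] (hk : 2 ≤ k) {γ δ S : ℝ} (hγ : 0 < γ) (hγ' : 3 * γ ≤ 1)
    (hδ : 0 < δ) (hS : 0 ≤ S) (h : (k : ℝ) * Real.log (1 / δ) / γ ≤ S) :
    OnlineWLC δ γ S (namingLearner (tripleEdge γ hγ.le hγ')) (singletonAdversary (k := k)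
      (S / (4 * γ))) := by
  intro T C hC
  have hk0 : (0 : ℝ) < k := Nat.cast_pos.2 (by omega)
  have hb : 0 ≤ S / (4 * γ) := by positivity
  refine PMF.ofReal_one_sub_le_toOuterMeasure _ _ (f := fun hist =>
    ENNReal.ofReal (Real.exp (2 * γ / k * regret γ hist -
        2 * (2 * γ / k * γ) * min (hist.length : ℝ) (S / (4 * γ)))) * ENNReal.ofReal δ)
    hδ.le ?_ ?_
  · intro hist hh
    have h1 : S < regret γ hist := by
      simp only [Set.mem_ofPred_eq, not_le] at hh
      rw [regret]
      linarith
    rw [← ENNReal.ofReal_mul (Real.exp_nonneg _), ENNReal.one_le_ofReal]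
    refine le_of_le_of_eq ?_ (congrArg (_ * ·) (Real.exp_log hδ))
    rw [← Real.exp_add]
    refine Real.one_le_exp ?_
    have h2 : -Real.log δ ≤ γ / k * S := by
      rw [one_div, Real.log_inv, div_le_iff₀ hγ] at h
      rw [div_mul_eq_mul_div, le_div_iff₀ hk0]
      linarith
    have h3 : 2 * γ / k * S ≤ 2 * γ / k * regret γ hist := by gcongr
    have h4 : 2 * (2 * γ / k * γ) * min (hist.length : ℝ) (S / (4 * γ)) ≤
        2 * (2 * γ / k * γ) * (S / (4 * γ)) := by
      gcongr
      exact min_le_right _ _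
    have h5 : 2 * (2 * γ / k * γ) * (S / (4 * γ)) = γ / k * S := by
      field_simp
      ring
    have h6 : 2 * γ / k * S = 2 * (γ / k * S) := by ring
    linarith
  · rw [PMF.expect_mul_const]
    exact mul_le_of_le_one_left zero_le (expect_exp_regret_le hk hγ.le hγ' hb hC T)

end Game

/-! ### Rank loss and overlap of likelihoods -/

section Overlap

variable {k : ℕ}

/-- Each of the two orders of a pair of labels is lost with at least the overlap of the two
likelihoods, whatever the scores, so the Bayes rank loss under a uniformly random relevant label is
at least half the overlap. -/
theorem half_le_average_rankLoss {α : Type*} [Fintype α] (hk : 2 ≤ k) {P : Fin k → α → ℝ}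
    {m : ℝ} (hm : ∀ y r, y ≠ r → m ≤ ∑ f, min (P y f) (P r f)) (s : α → Fin k → ℝ) :
    m / 2 ≤ (∑ y, ∑ f, P y f * rankLoss {y} (s f)) / k := by
  have hk' : (2 : ℝ) ≤ k := by exact_mod_cast hk
  set φ : (Fin k → ℝ) → Fin k → Fin k → ℝ := fun v l r =>
    (if v l < v r then 1 else 0) + 1 / 2 * (if v l = v r then 1 else 0) with hφ
  set K : Fin k → Fin k → ℝ := fun y r => if r = y then 0 else ∑ f, P y f * φ (s f) y r with hK
  have hsum : ∑ y, ∑ f, P y f * rankLoss {y} (s f) = (∑ y, ∑ r, K y r) / ((k : ℝ) - 1) := by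
    rw [Finset.sum_div]
    refine Finset.sum_congr rfl fun y _ => ?_
    have h1 : ∀ v : Fin k → ℝ, rankLoss {y} v = (∑ r ∈ {y}ᶜ, φ v y r) / ((k : ℝ) - 1) := by
      intro v
      rw [rankLoss, Finset.card_compl, Finset.card_singleton, Fintype.card_fin,
        Nat.cast_sub (by omega), Finset.sum_singleton]
      push_cast
      ring
    simp only [h1, mul_div_assoc', ← Finset.sum_div, Finset.mul_sum]
    rw [Finset.sum_comm]
    congr 1
    rw [← Finset.sum_subset (Finset.subset_univ ({y}ᶜ : Finset (Fin k)))]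
    · refine Finset.sum_congr rfl fun r hr => ?_
      rw [hK]
      simp only [Finset.mem_compl, Finset.mem_singleton] at hr
      simp only [if_neg hr]
    · intro r _ hr
      simp only [Finset.mem_compl, Finset.mem_singleton, not_not] at hr
      simp [hK, hr]
  have hpair : ∀ y r, (if r = y then 0 else m) ≤ K y r + K r y := by
    intro y r
    by_cases h : r = y
    · simp [hK, h]
    · simp only [hK, if_neg h, if_neg (Ne.symm h)]
      refine (hm y r (Ne.symm h)).trans ?_
      rw [← Finset.sum_add_distrib]
      refine Finset.sum_le_sum fun f _ => ?_
      have h1 := min_le_left (P y f) (P r f)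
      have h2 := min_le_right (P y f) (P r f)
      simp only [hφ]
      rcases lt_trichotomy (s f y) (s f r) with h3 | h3 | h3
      · simp [h3, h3.not_gt, h3.ne, h3.ne']
      · simp only [h3, lt_irrefl, if_true, if_false]
        linarith
      · simp [h3, h3.not_gt, h3.ne, h3.ne']
  have htot : (k : ℝ) * ((k - 1) * m) ≤ 2 * ∑ y, ∑ r, K y r := by
    calc (k : ℝ) * ((k - 1) * m) = ∑ y : Fin k, ∑ r : Fin k, if r = y then 0 else m := by
          have : ∀ y r : Fin k, (if r = y then 0 else m) = m - if r = y then m else 0 := by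
            intro y r
            split_ifs <;> simp
          simp only [this, Finset.sum_sub_distrib]
          simp
          ring
      _ ≤ ∑ y, ∑ r, (K y r + K r y) :=
          Finset.sum_le_sum fun y _ => Finset.sum_le_sum fun r _ => hpair y r
      _ = 2 * ∑ y, ∑ r, K y r := by
          simp only [Finset.sum_add_distrib]
          rw [Finset.sum_comm (f := fun y r => K r y)]
          ring
  rw [hsum, div_div, le_div_iff₀ (mul_pos (by linarith) (by linarith))]
  linarith

theorem sum_prod_baseline (g : ℝ) (y : Fin k) (N : ℕ) :
    ∑ f : Fin N → Fin k, ∏ i, baseline g {y} (f i) = 1 := by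
  rw [← Fintype.sum_pow, sum_baseline_singleton, one_pow]

/-- The Bhattacharyya coefficient of two baseline distributions. Up to the lower bound
`q (4 q + 3 g) / (4 q + g)` for `√(q (q + g))`, where `q = (1 - g) / k`, it is computed exactly. -/
theorem one_sub_le_sum_sqrt_baseline {g : ℝ} (hg : 0 ≤ g) (hg' : g < 1) {a b : Fin k}
    (hab : a ≠ b) :
    1 - g ^ 2 / (4 * ((1 - g) / k) + g) ≤
      ∑ l, √(baseline g {a} l * baseline g {b} l) := by
  have hk0 : (0 : ℝ) < k := Nat.cast_pos.2 a.pos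
  obtain ⟨q, hq⟩ : ∃ q, q = (1 - g) / k := ⟨_, rfl⟩
  have hq0 : 0 < q := hq ▸ div_pos (by linarith) hk0
  have hkq : k * q = 1 - g := by rw [hq]; field_simp
  have hs : q * (4 * q + 3 * g) / (4 * q + g) ≤ √(q * (q + g)) := by
    refine Real.le_sqrt_of_sq_le ?_
    rw [div_pow, div_le_iff₀ (by positivity)]
    have : 0 ≤ q * g ^ 3 := by positivity
    nlinarith
  have hterm : ∀ l, q + ((if l = a then √(q * (q + g)) - q else 0) +
      if l = b then √(q * (q + g)) - q else 0) = √(baseline g {a} l * baseline g {b} l) := by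
    intro l
    rw [baseline_singleton, baseline_singleton, ← hq]
    by_cases ha : l = a
    · subst ha
      simp [hab, mul_comm]
    · by_cases hb : l = b
      · simp [hb, hab.symm]
      · simp [ha, hb, hq0.le]
  rw [← Finset.sum_congr rfl fun l _ => hterm l, ← hq]
  simp only [Finset.sum_add_distrib, Finset.sum_const, Finset.card_univ, Fintype.card_fin,
    nsmul_eq_mul, Finset.sum_ite_eq', Finset.mem_univ, if_true, hkq]
  have h2 : q * (4 * q + 3 * g) / (4 * q + g) = q + g / 2 - g ^ 2 / (4 * q + g) / 2 := by
    field_simp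
    ring
  linarith

/-- Edge `3γ` leaves a Bhattacharyya coefficient `exp (-O(k γ²))`, uniformly up to `γ = 1 / (2k)`. -/
theorem exp_neg_le_sum_sqrt_baseline (hk : 2 ≤ k) {γ : ℝ} (hγ : 0 < γ)
    (hγ' : γ < 1 / (2 * (k : ℝ))) {a b : Fin k} (hab : a ≠ b) :
    Real.exp (-(36 * k * γ ^ 2)) ≤ ∑ l, √(baseline (3 * γ) {a} l * baseline (3 * γ) {b} l) := by
  have hk' : (2 : ℝ) ≤ k := by exact_mod_cast hk
  have hγ4 : 4 * γ < 1 := by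
    rw [lt_div_iff₀ (by positivity)] at hγ'
    nlinarith
  refine le_trans ?_ (one_sub_le_sum_sqrt_baseline (by positivity) (by linarith) hab)
  obtain ⟨q, hq⟩ : ∃ q, q = (1 - 3 * γ) / k := ⟨_, rfl⟩
  have hkq : k * q = 1 - 3 * γ := by rw [hq]; field_simp
  have hq0 : 0 < q := hq ▸ div_pos (by linarith) (by linarith)
  rw [← hq]
  obtain ⟨x, hx⟩ : ∃ x, x = (3 * γ) ^ 2 / (4 * q + 3 * γ) := ⟨_, rfl⟩
  rw [← hx]
  have hx0 : 0 ≤ x := by rw [hx]; positivity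
  have hx1 : x ≤ 9 * k * γ ^ 2 := by
    rw [hx, div_le_iff₀ (by positivity)]
    have h1 : 1 ≤ k * (4 * q + 3 * γ) := by nlinarith
    nlinarith [mul_le_mul_of_nonneg_left h1 (by positivity : 0 ≤ 9 * γ ^ 2)]
  have hx2 : x ≤ 3 / 4 := by
    rw [hx, div_le_iff₀ (by positivity)]
    nlinarith
  calc Real.exp (-(36 * k * γ ^ 2)) ≤ Real.exp (-(4 * x)) := Real.exp_le_exp.2 (by linarith)
    _ ≤ 1 - x := by
      rw [Real.exp_neg, inv_le_comm₀ (Real.exp_pos _) (by linarith),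
        inv_le_iff_one_le_mul₀ (by linarith)]
      nlinarith [Real.add_one_le_exp (4 * x)]

/-- By the Cauchy-Schwarz inequality two probability vectors `P` and `Q` with overlap `m` satisfy
`(∑ √(P Q))² ≤ (∑ min P Q) (∑ max P Q) = m (2 - m)`; the Bhattacharyya coefficient of product
distributions is a power. -/
theorem overlap_ge_of_sum_sqrt {g : ℝ} (hg : 0 ≤ g) (hg' : g ≤ 1) {ε : ℝ} (hε : ε ≤ 1 / 2)
    {N : ℕ} {a b : Fin k}
    (h : 4 * ε * (1 - ε) ≤ ((∑ l, √(baseline g {a} l * baseline g {b} l)) ^ N) ^ 2) :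
    2 * ε ≤ ∑ f : Fin N → Fin k,
      min (∏ i, baseline g {a} (f i)) (∏ i, baseline g {b} (f i)) := by
  set P := fun f : Fin N → Fin k => ∏ i, baseline g {a} (f i)
  set Q := fun f : Fin N → Fin k => ∏ i, baseline g {b} (f i)
  have hP : ∀ f, 0 ≤ P f := fun f =>
    Finset.prod_nonneg fun i _ => baseline_singleton_nonneg hg hg' a _
  have hQ : ∀ f, 0 ≤ Q f := fun f =>
    Finset.prod_nonneg fun i _ => baseline_singleton_nonneg hg hg' b _
  have hP1 : ∑ f, P f = 1 := sum_prod_baseline g a N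
  have hQ1 : ∑ f, Q f = 1 := sum_prod_baseline g b N
  have hmax : ∑ f, max (P f) (Q f) = 2 - ∑ f, min (P f) (Q f) := by
    rw [eq_sub_iff_add_eq', ← Finset.sum_add_distrib]
    simp only [min_add_max, Finset.sum_add_distrib, hP1, hQ1]
    norm_num
  have hle : ∑ f, min (P f) (Q f) ≤ 1 :=
    hP1 ▸ Finset.sum_le_sum fun f _ => min_le_left _ _
  have hpow : (∑ l, √(baseline g {a} l * baseline g {b} l)) ^ N = ∑ f, √(P f * Q f) := by
    rw [Fintype.sum_pow]
    refine Finset.sum_congr rfl fun f _ => ?_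
    simp only [P, Q]
    rw [← Finset.prod_mul_distrib, Real.sqrt_prod]
    exact fun i _ => mul_nonneg (baseline_singleton_nonneg hg hg' a _)
      (baseline_singleton_nonneg hg hg' b _)
  have hcs : (∑ f, √(P f * Q f)) ^ 2 ≤ (∑ f, min (P f) (Q f)) * ∑ f, max (P f) (Q f) := by
    refine Finset.sum_sq_le_sum_mul_sum_of_sq_le_mul _ (fun f _ => le_min (hP f) (hQ f))
      (fun f _ => (hP f).trans (le_max_left _ _)) fun f _ => ?_
    rw [Real.sq_sqrt (mul_nonneg (hP f) (hQ f)), min_mul_max]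
  rw [hpow] at h
  rw [hmax] at hcs
  by_contra hlt
  push Not at hlt
  nlinarith

end Overlap

/-! ### Expected loss of a booster -/

section Booster

variable {k N : ℕ} {X : Type} {Ω : Type*}

theorem length_of_mem_support_boostRun (adv : Adversary k X) (WL : Fin N → WeakLearner k X)
    (B : Booster k N X Ω) (ω : Ω) (T : ℕ) :
    ∀ hist ∈ (boostRun adv WL B ω T).support, hist.length = T := by
  induction T with
  | zero =>
    intro hist h
    rw [boostRun, PMF.mem_support_pure_iff] at h
    simp [h]
  | succ T ih =>
    intro hist h
    simp only [boostRun, PMF.mem_support_bind_iff, PMF.mem_support_map_iff] at h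
    obtain ⟨hist', h1, e, -, p, -, rfl⟩ := h
    simp [ih hist' h1]

theorem rankLoss_nonneg (Y : Finset (Fin k)) (s : Fin k → ℝ) : 0 ≤ rankLoss Y s := by
  unfold rankLoss
  positivity

theorem sum_rankLoss_nonneg (hist : List (BoostRound k N X)) :
    0 ≤ (hist.map fun r => rankLoss r.label r.score).sum := by
  refine List.sum_nonneg fun x hx => ?_
  obtain ⟨r, -, rfl⟩ := List.mem_map.1 hx
  exact rankLoss_nonneg _ _

/-- Lower bounds for the conditional expectations of the losses of the rounds add up. -/
theorem ofReal_sum_le_expect_boostRun (adv : Adversary k X) (WL : Fin N → WeakLearner k X)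
    (B : Booster k N X Ω) (ω : Ω) {ρ : ℕ → ℝ} (hρ : ∀ t, 0 ≤ ρ t)
    (h : ∀ hist : List (BoostRound k N X), ENNReal.ofReal (ρ hist.length) ≤
      (adv (hist.map fun r => (r.inst, r.label))).expect fun e =>
        (independentDraws N fun i => WL i (hist.map (BoostRound.feedback i)) e.1).expect fun h =>
          ENNReal.ofReal (rankLoss e.2 (B.decide ω hist h))) (T : ℕ) :
    ENNReal.ofReal (∑ t ∈ Finset.range T, ρ t) ≤
      (boostRun adv WL B ω T).expect fun hist =>
        ENNReal.ofReal (hist.map fun r => rankLoss r.label r.score).sum := by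
  induction T with
  | zero => simp
  | succ T ih =>
    rw [Finset.sum_range_succ, ENNReal.ofReal_add (Finset.sum_nonneg fun t _ => hρ t) (hρ T),
      boostRun, PMF.expect_bind]
    refine (add_le_add_left ih _).trans ?_
    rw [← PMF.expect_const (boostRun adv WL B ω T) (ENNReal.ofReal (ρ T)), ← PMF.expect_add]
    refine PMF.expect_mono_of_support _ fun hist hh => ?_
    have hlen := length_of_mem_support_boostRun adv WL B ω T hist hh
    rw [PMF.expect_bind]
    simp only [PMF.expect_map, List.map_cons, List.sum_cons,
      ENNReal.ofReal_add (rankLoss_nonneg _ _) (sum_rankLoss_nonneg hist), PMF.expect_add,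
      PMF.expect_const]
    rw [add_comm]
    gcongr
    exact hlen ▸ h hist

/-- The expected loss of one round: in an uninformative round no booster beats random guessing, and
in an informative one it cannot beat the overlap of the laws of the weak predictions. -/
theorem le_expect_rankLoss [NeZero k] (hk : 2 ≤ k) {g : Bool → unitInterval} (hg : g false = 0)
    {ε : ℝ}
    (hov : ∀ a b : Fin k, a ≠ b → 2 * ε ≤ ∑ f : Fin N → Fin k,
      min (∏ i, baseline (g true) {a} (f i)) (∏ i, baseline (g true) {b} (f i)))
    (b : ℝ) (hist : List ((Fin k × Bool) × Finset (Fin k)))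
    (lhist : Fin N → List (Feedback k (Fin k × Bool)))
    (s : (Fin N → WeakPrediction k) → Fin k → ℝ) :
    ENNReal.ofReal (uninformativeProb b hist.length * (1 / 2) +
        (1 - uninformativeProb b hist.length) * ε) ≤
      (singletonAdversary b hist).expect fun e =>
        (independentDraws N fun i => namingLearner g (lhist i) e.1).expect fun h =>
          ENNReal.ofReal (rankLoss e.2 (s h)) := by
  obtain ⟨P, hP⟩ : ∃ P : Bool → Fin k → (Fin N → Fin k) → ℝ, P = fun i y f =>
    ∏ j, baseline (g i) {y} (f j) := ⟨_, rfl⟩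
  obtain ⟨v, hv⟩ : ∃ v : (Fin N → Fin k) → Fin k → ℝ, v = fun f =>
    s fun j => stdSimplex.vertex (f j) := ⟨_, rfl⟩
  rw [expect_singletonAdversary (R := fun y i => ∑ f, P i y f * rankLoss {y} (v f)) b hist
    (fun y i => Finset.sum_nonneg fun f _ => mul_nonneg (hP ▸ Finset.prod_nonneg fun j _ =>
      baseline_singleton_nonneg (g i).2.1 (g i).2.2 y _) (rankLoss_nonneg _ _))]
  · have h0 := (uninformativeProb b hist.length).2.1
    have h1 := (uninformativeProb b hist.length).2.2
    refine ENNReal.ofReal_le_ofReal (add_le_add (mul_le_mul_of_nonneg_left ?_ h0)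
      (mul_le_mul_of_nonneg_left ?_ (sub_nonneg.2 h1)))
    · refine half_le_average_rankLoss hk (fun y r _ => ?_) v
      have : P false r = P false y := by
        simp [hP, hg, baseline_singleton]
      rw [this]
      simp only [min_self]
      rw [hP, sum_prod_baseline]
    · have := half_le_average_rankLoss hk (P := P true) (m := 2 * ε) (by rw [hP]; exact hov) v
      linarith
  · intro y i
    simp only [namingLearner]
    rw [expect_independentDraws _ _ _ fun h => rankLoss_nonneg _ _]
    rw [hP, hv]
    rfl

end Booster

/-! ### The lower bounds -/

/-- Comparison of `ln (1 / (4 ε (1 - ε)))` and `ln (1 / ε)` for `ε` bounded away from `1 / 2`. -/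
theorem exists_mul_log_le_neg_log {ε₀ : ℝ} (h0 : 0 < ε₀) (h1 : ε₀ < 1 / 2) :
    ∃ c : ℝ, 0 < c ∧ ∀ ε, 0 < ε → ε ≤ ε₀ →
      c * Real.log (1 / ε) ≤ -Real.log (4 * ε * (1 - ε)) := by
  have hlog16 : 0 < Real.log 16 := Real.log_pos (by norm_num)
  have hneg : Real.log (4 * ε₀ * (1 - ε₀)) < 0 :=
    Real.log_neg (by nlinarith) (by nlinarith [sq_pos_of_pos (by linarith : 0 < 1 - 2 * ε₀)])
  refine ⟨min (1 / 2) (-Real.log (4 * ε₀ * (1 - ε₀)) / Real.log 16),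
    lt_min (by norm_num) (div_pos (by linarith) hlog16), fun ε hε hle => ?_⟩
  have hlogε : 0 ≤ Real.log (1 / ε) := Real.log_nonneg (by
    rw [le_div_iff₀ hε]
    linarith)
  rcases le_total ε (1 / 16) with h | h
  · -- here `4 ε (1 - ε) ≤ 4 ε ≤ √ε`
    have h2 : 2 * Real.log (4 * ε * (1 - ε)) ≤ Real.log ε := by
      rw [← Real.log_rpow (by nlinarith), Real.rpow_two]
      refine Real.log_le_log (by nlinarith [sq_pos_of_pos (mul_pos hε (by linarith : 0 < 1 - ε))])
        ?_
      have h3 : (4 * ε * (1 - ε)) ^ 2 ≤ (4 * ε) ^ 2 := by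
        apply pow_le_pow_left₀ <;> nlinarith
      nlinarith
    have h4 := mul_le_mul_of_nonneg_right (min_le_left (1 / 2 : ℝ)
      (-Real.log (4 * ε₀ * (1 - ε₀)) / Real.log 16)) hlogε
    have h5 : Real.log (1 / ε) = -Real.log ε := by rw [one_div, Real.log_inv]
    linarith
  · have h4 := mul_le_mul_of_nonneg_right (min_le_right (1 / 2 : ℝ)
      (-Real.log (4 * ε₀ * (1 - ε₀)) / Real.log 16)) hlogε
    have h5 : Real.log (1 / ε) ≤ Real.log 16 := by
      refine Real.log_le_log (by positivity) ?_
      rw [div_le_iff₀ hε]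
      linarith
    have h6 : -Real.log (4 * ε₀ * (1 - ε₀)) / Real.log 16 * Real.log (1 / ε) ≤
        -Real.log (4 * ε₀ * (1 - ε₀)) := by
      rw [div_mul_eq_mul_div, div_le_iff₀ hlog16]
      exact mul_le_mul_of_nonneg_left h5 (by linarith)
    have h7 : Real.log (4 * ε * (1 - ε)) ≤ Real.log (4 * ε₀ * (1 - ε₀)) :=
      Real.log_le_log (by nlinarith) (by nlinarith)
    linarith

theorem theorem2 (k : ℕ) (hk : 2 ≤ k) (ε₀ : ℝ) (hε₀ : 0 < ε₀) (hε₀' : ε₀ < 1 / 2) :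
    ∃ c : ℝ, 0 < c ∧ ∀ γ δ ε S : ℝ, 0 < γ → γ < 1 / (2 * (k : ℝ)) → 0 < δ → δ < 1 →
      0 < ε → ε ≤ ε₀ → (k : ℝ) * Real.log (1 / δ) / γ ≤ S →
      ∃ (X : Type) (adv : Adversary k X) (WL : ℕ → WeakLearner k X),
        (∀ i, OnlineWLC δ γ S (WL i) adv) ∧
        ∀ (N T : ℕ) (select : Fin N → ℕ) (Ω : Type*) [MeasurableSpace Ω]
          (P : MeasureTheory.Measure Ω) [MeasureTheory.IsProbabilityMeasure P]
          (B : Booster k N X Ω), 0 < T →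
          errorRate P adv (fun i => WL (select i)) B T < ENNReal.ofReal ε →
          c * (1 / γ ^ 2 * Real.log (1 / ε)) ≤ (N : ℝ) ∧ c * (S / (ε * γ)) ≤ (T : ℝ) := by
  have : NeZero k := ⟨by omega⟩
  have hk' : (2 : ℝ) ≤ k := by exact_mod_cast hk
  obtain ⟨c₁, hc₁, hlog⟩ := exists_mul_log_le_neg_log hε₀ hε₀'
  refine ⟨min (c₁ / (72 * k)) (1 / 8), lt_min (by positivity) (by norm_num), ?_⟩
  intro γ δ ε S hγ hγ' hδ hδ' hε hεle hS
  have hγ4 : 4 * γ < 1 := by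
    rw [lt_div_iff₀ (by positivity)] at hγ'
    nlinarith
  have hγ3 : 3 * γ ≤ 1 := by linarith
  have hlogδ : 0 < Real.log (1 / δ) := Real.log_pos (by rw [lt_div_iff₀ hδ]; linarith)
  have hS0 : 0 < S := lt_of_lt_of_le (by positivity) hS
  have hb : 0 ≤ S / (4 * γ) := by positivity
  refine ⟨Fin k × Bool, singletonAdversary (S / (4 * γ)),
    fun _ => namingLearner (tripleEdge γ hγ.le hγ3),
    fun _ => onlineWLC_namingLearner hk hγ hγ3 hδ hS0.le hS, ?_⟩
  intro N T select Ω _ P _ B hT herr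
  have hT' : (0 : ℝ) < T := Nat.cast_pos.2 hT
  -- the total loss is bounded below once the overlap of the laws of the predictions is
  have total : ∀ η : ℝ, 0 ≤ η →
      (∀ a b : Fin k, a ≠ b → 2 * η ≤ ∑ f : Fin N → Fin k,
        min (∏ i, baseline (3 * γ) {a} (f i)) (∏ i, baseline (3 * γ) {b} (f i))) →
      min (T : ℝ) (S / (4 * γ)) * (1 / 2) + (T - min (T : ℝ) (S / (4 * γ))) * η < ε * T := by
    intro η hη hov
    set ρ : ℕ → ℝ := fun t => uninformativeProb (S / (4 * γ)) t * (1 / 2) +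
      (1 - uninformativeProb (S / (4 * γ)) t) * η with hρ
    have hρ0 : ∀ t, 0 ≤ ρ t := fun t => by
      have h0 := (uninformativeProb (S / (4 * γ)) t).2.1
      have h1 := sub_nonneg.2 (uninformativeProb (S / (4 * γ)) t).2.2
      positivity
    have hsum : ∑ t ∈ Finset.range T, ρ t =
        min (T : ℝ) (S / (4 * γ)) * (1 / 2) + (T - min (T : ℝ) (S / (4 * γ))) * η := by
      rw [hρ, Finset.sum_add_distrib, ← Finset.sum_mul, ← Finset.sum_mul, Finset.sum_sub_distrib,
        sum_uninformativeProb hb]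
      simp
    rw [← hsum, ← div_lt_iff₀ hT']
    refine (ENNReal.ofReal_lt_ofReal_iff hε).1 (lt_of_le_of_lt ?_ herr)
    calc ENNReal.ofReal ((∑ t ∈ Finset.range T, ρ t) / T)
        = ∫⁻ _ : Ω, ENNReal.ofReal ((∑ t ∈ Finset.range T, ρ t) / T) ∂P := by simp
      _ ≤ _ := by
        refine MeasureTheory.lintegral_mono fun ω => ?_
        have h1 := ofReal_sum_le_expect_boostRun (singletonAdversary (S / (4 * γ)))
          (fun _ => namingLearner (tripleEdge γ hγ.le hγ3)) B ω hρ0 (fun hist => by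
            have := le_expect_rankLoss hk (g := tripleEdge γ hγ.le hγ3) rfl hov (S / (4 * γ))
              (hist.map fun r => (r.inst, r.label))
              (fun i => hist.map (BoostRound.feedback i)) (B.decide ω hist)
            rwa [List.length_map] at this) T
        have h2 := mul_le_mul_left h1 (ENNReal.ofReal T)⁻¹
        rw [← PMF.expect_mul_const] at h2
        simp only [← div_eq_mul_inv, ← ENNReal.ofReal_div_of_pos hT'] at h2
        exact h2
  constructor
  · -- otherwise the overlap is at least `2 ε`, and every round costs `ε` at least
    by_contra hN
    push Not at hN
    have hN2 : 72 * k * γ ^ 2 * N < c₁ * Real.log (1 / ε) := by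
      have hlogε : 0 ≤ 1 / γ ^ 2 * Real.log (1 / ε) := mul_nonneg (by positivity)
        (Real.log_nonneg (by rw [le_div_iff₀ hε]; linarith))
      have h1 := hN.trans_le (mul_le_mul_of_nonneg_right (min_le_left _ _) hlogε)
      calc 72 * k * γ ^ 2 * N < 72 * k * γ ^ 2 * (c₁ / (72 * k) * (1 / γ ^ 2 * Real.log (1 / ε))) :=
            mul_lt_mul_of_pos_left h1 (by positivity)
        _ = _ := by field_simp
    have h4 : 0 < 4 * ε * (1 - ε) := mul_pos (by linarith) (by linarith)
    have hov := total ε hε.le fun a b hab => by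
      refine overlap_ge_of_sum_sqrt (by positivity) hγ3 (by linarith) ?_
      calc 4 * ε * (1 - ε) = Real.exp (Real.log (4 * ε * (1 - ε))) := (Real.exp_log h4).symm
        _ ≤ Real.exp (-(72 * k * γ ^ 2 * N)) := Real.exp_le_exp.2 (by linarith [hlog ε hε hεle])
        _ = (Real.exp (-(36 * k * γ ^ 2)) ^ N) ^ 2 := by
            rw [← Real.exp_nat_mul, ← Real.exp_nat_mul]
            push_cast
            congr 1
            ring
        _ ≤ _ := by
            gcongr
            exact exp_neg_le_sum_sqrt_baseline hk hγ hγ' hab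
    nlinarith [le_min hT'.le hb]
  · have h := total 0 le_rfl fun a b _ => by
      rw [mul_zero]
      exact Finset.sum_nonneg fun f _ => le_min
        (Finset.prod_nonneg fun i _ => baseline_singleton_nonneg (by linarith) hγ3 a _)
        (Finset.prod_nonneg fun i _ => baseline_singleton_nonneg (by linarith) hγ3 b _)
    have hlt : S / (4 * γ) ≤ T := by
      by_contra hlt
      push Not at hlt
      rw [min_eq_left hlt.le] at h
      nlinarith
    rw [min_eq_right hlt] at h
    calc _ ≤ 1 / 8 * (S / (ε * γ)) := by
          gcongr
          exact min_le_right _ _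
      _ = S / (4 * γ) * (1 / 2) / ε := by
          field_simp
          norm_num
      _ ≤ T := by
          rw [div_le_iff₀ hε]
          linarith
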